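/- Let $1\le k\le N$ be integers, $n=\lceil N/k\rceil$ and $\ell=nk-N$. Let $\mathcal J_{k,N}$ be the set of Hermitian matrices $\mathbf J\in\mathbb C^{N\times N}$ that are block tridiagonal with Hermitian diagonal blocks $\mathbf A_0,\dots,\mathbf A_{n-2}\in\mathbb C^{k\times k}$, $\mathbf A_{n-1}\in\mathbb C^{(k-\ell)\times(k-\ell)}$ and full-rank subdiagonal blocks $\mathbf B_0,\dots,\mathbf B_{n-3}\in\mathbb C^{k\times k}$, $\mathbf B_{n-2}\in\mathbb C^{(k-\ell)\times k}$ (and superdiagonal blocks $\mathbf B_j^*$), such that $\mathbf B_0,\dots,\mathbf B_{n-3}$ are upper triangular with strictly positive diagonal entries and $\mathbf B_{n-2}$ is in row echelon form with positive leading entries. The spectral measure of $\mathbf J\in\mathcal J_{k,N}$ is the $k\times k$ matrix-valued measure $\varphi(\mathbf J)=\sum_{j=1}^N \mathbf v_j\mathbf v_j^*\,\delta_{\lambda_j}$ on $\mathbb R$, where $\lambda_1,\dots,\lambda_N$ are the eigenvalues of $\mathbf J$, with multiplicity, and $\mathbf v_j\in\mathbb C^k$ consists of the first $k$ components of the $j$-th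 vector of a corresponding orthonormal basis of eigenvectors (the measure does not depend on the choice of this basis). Let $\boldsymbol\mu=\sum_{j=1}^m \mathbf V_j\mathbf V_j^*\,\delta_{x_j}$, where the points $x_1,\dots,x_m\in\mathbb R$ are distinct, $\mathbf V_j\in\mathbb C^{k\times n_j}$ with $n_j\le k$, and $\sum_{j=1}^m n_j=N$, and suppose that $\boldsymbol\mu$ is normalized, i.e. $\boldsymbol\mu(\mathbb R)=\sum_{j=1}^m\mathbf V_j\mathbf V_j^*=\mathbf I_k$. Define $$\mathbf X=\mathrm{diag}(\underbrace{x_1,\dots,x_1}_{n_1},\dots,\underbrace{x_m,\dots,x_m}_{n_m})\in\mathbb C^{N\times N},\qquad \mathbf V^*=\begin{bmatrix}\mathbf V_1&\cdots&\mathbf V_m\end{bmatrix},\quad \mathbf V\in\mathbb C^{N\times k}.$$ Then $\boldsymbol\mu$ is the spectral measure of some matrix in $\mathcal J_{k,N}$ if and only if, for every integer $d\ge 0$, the matrix $$\begin{bmatrix}\mathbf V&\mathbf X\mathbf V&\cdots&\mathbf X^d\mathbf V\end{bmatrix}\in\mathbb C^{N\times(d+1)k}$$ has full rank, i.e. rank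 $\min\{(d+1)k,N\}$. -/

import Mathlib

open MeasureTheory
open scoped Matrix ComplexOrder

noncomputable section

namespace BandedSpectral

/-- A matrix has full rank: its rank is the smaller of its two dimensions. -/
def HasFullRank {p q : Type*} [Fintype p] [Fintype q] (M : Matrix p q ℂ) : Prop :=
  M.rank = min (Fintype.card p) (Fintype.card q)

/-! ### Matrix-valued measures on the real line -/

/-- Countably additive set functions on the Borel sets of `ℝ` with values in `ℂ^{k×k}`. -/
abbrev MatrixMeasure (k : ℕ) : Type := VectorMeasure ℝ (Matrix (Fin k) (Fin k) ℂ)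

/-- `μ` takes positive semidefinite values and is normalized, `μ(ℝ) = I`. -/
def IsNormalizedMeasure {k : ℕ} (μ : MatrixMeasure k) : Prop :=
  (∀ s, MeasurableSet s → (μ s).PosSemidef) ∧ μ Set.univ = 1

/-- The finite matrix measure `∑ j, W j δ_{x j}`. -/
def atomicMeasure {ι : Type*} [Fintype ι] {k : ℕ} (x : ι → ℝ)
    (W : ι → Matrix (Fin k) (Fin k) ℂ) : MatrixMeasure k :=
  ∑ j, VectorMeasure.dirac (x j) (W j)

/-! ### The class of banded matrices -/

/-- The size of the `b`-th block (counted from `0`) when `0, …, N - 1` is cut into consecutive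
blocks of length `k`, the last one possibly shorter. -/
def blockSize (k N b : ℕ) : ℕ := min k (N - b * k)

/-- The position in `0, …, N - 1` of the `r`-th element of the `b`-th block. -/
def blockIndex (k N b : ℕ) (r : Fin (blockSize k N b)) : Fin N :=
  ⟨b * k + r, by have h := r.isLt; unfold blockSize at h; omega⟩

/-- The block of `J` in block row `a` and block column `b`. -/
def block {k N : ℕ} (J : Matrix (Fin N) (Fin N) ℂ) (a b : ℕ) :
    Matrix (Fin (blockSize k N a)) (Fin (blockSize k N b)) ℂ :=
  J.submatrix (blockIndex k N a) (blockIndex k N b)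

/-- Membership in the class `𝒥_{k,N}`. With `n = ⌈N/k⌉` blocks, `block J j j` is `A_j` for
`j ≤ n - 1` and `block J (j + 1) j` is `B_j` for `j ≤ n - 2`. -/
structure IsBanded (k N : ℕ) (J : Matrix (Fin N) (Fin N) ℂ) : Prop where
  isHermitian : J.IsHermitian
  diag_isHermitian : ∀ j < N ⌈/⌉ k, (block (k := k) J j j).IsHermitian
  tridiagonal : ∀ a < N ⌈/⌉ k, ∀ b < N ⌈/⌉ k, (a + 1 < b ∨ b + 1 < a) → block (k := k) J a b = 0
  fullRank : ∀ j, j + 1 < N ⌈/⌉ k → HasFullRank (block (k := k) J (j + 1) j)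
  upperTriangular : ∀ j, j + 2 < N ⌈/⌉ k → ∀ r c, c.val < r.val → block (k := k) J (j + 1) j r c = 0
  diag_pos : ∀ j, j + 2 < N ⌈/⌉ k → ∀ r c, r.val = c.val → 0 < block (k := k) J (j + 1) j r c
  last_isRowEchelon : ∀ j, j + 2 = N ⌈/⌉ k → (block (k := k) J (j + 1) j).IsRowEchelon
  last_pivot_pos : ∀ j, j + 2 = N ⌈/⌉ k → ∀ r c,
    (block (k := k) J (j + 1) j).IsLeadingEntry r c → 0 < block (k := k) J (j + 1) j r c

/-- The spectral measure `∑ j, v_j v_j^* δ_{λ_j}` of a Hermitian matrix: the `λ_j` are its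
eigenvalues (with multiplicity) and `v_j` is made of the first `k` components of the `j`-th vector
of an orthonormal eigenbasis. -/
def spectralMeasure {k N : ℕ} (hkN : k ≤ N) (J : Matrix (Fin N) (Fin N) ℂ) (hJ : J.IsHermitian) :
    MatrixMeasure k :=
  atomicMeasure hJ.eigenvalues fun j =>
    let v : Fin k → ℂ := fun i => hJ.eigenvectorBasis j (Fin.castLE hkN i)
    Matrix.vecMulVec v (star v)

/-! ### The block Krylov matrices -/

section Krylov

variable {m k : ℕ} {n : Fin m → ℕ}

/-- `X = diag(x_1, …, x_1, …, x_m, …, x_m)`, with `x_j` repeated `n_j` times. -/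
def pointMatrix (n : Fin m → ℕ) (x : Fin m → ℝ) :
    Matrix (Σ j, Fin (n j)) (Σ j, Fin (n j)) ℂ :=
  Matrix.diagonal fun p => (x p.1 : ℂ)

/-- The matrix `V` with `k` columns such that `V^* = [V_1 ⋯ V_m]`. -/
def stackedMatrix (V : ∀ j, Matrix (Fin k) (Fin (n j)) ℂ) : Matrix (Σ j, Fin (n j)) (Fin k) ℂ :=
  (Matrix.of fun i (p : Σ j, Fin (n j)) => V p.1 i p.2)ᴴ

/-- The matrix `[V, X V, …, X^d V]`. -/
def krylovMatrix (x : Fin m → ℝ) (V : ∀ j, Matrix (Fin k) (Fin (n j)) ℂ) (d : ℕ) :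
    Matrix (Σ j, Fin (n j)) (Fin (d + 1) × Fin k) ℂ :=
  Matrix.of fun p c => (pointMatrix n x ^ (c.1 : ℕ) * stackedMatrix V) p c.2

end Krylov

end BandedSpectral

end

open MeasureTheory
open scoped Matrix ComplexOrder

noncomputable section

namespace BandedSpectral

/-! ### Atomic measures and their moments -/

/-! Everything passes through moments. A finitely supported matrix measure is determined by its
moments (`atomicMeasure_eq_iff_moments`); those of the spectral measure of `J` are `Eᴴ * J ^ i * E`,
with `E` the first `k` columns of the identity, and those of `μ` are `Vᴴ * X ^ i * V`. So `μ` is the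
spectral measure of `J` exactly when the pairs `(J, E)` and `(X, V)` have the same moments.

Necessity: the Gram matrix of `[B, A B, …, A^d B]` consists of moments, so its rank depends on the
moments alone (`rank_blockKrylov_eq_of_moments`). For a banded `J` the full-rank subdiagonal blocks
let each power of `J` reach one further block of coordinate vectors, so the rank is maximal
(`IsBanded.hasFullRank_blockKrylov`).

Sufficiency (`exists_isBanded_of_hasFullRank`): apply Gram–Schmidt to the columns of `V, X V, X² V,
…` in order, drop the zero vectors, and let `J` be the matrix of `X` in the resulting orthonormal
basis. Let `p s` be the position in the column sequence of the `s`-th vector kept. As `X` shifts the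
sequence by `k`, the entry of `J` at `(r, c)` vanishes if `p c + k < p r` and is positive if `p c +
k = p r`. Full rank confines the dropped vectors to the last block, where they yield the echelon
form of the last subdiagonal block (`isBanded_of_profile`). Normalization makes the columns of `V`
orthonormal, so Gram–Schmidt keeps them and `V` becomes `E`. -/

theorem atomicMeasure_apply {ι : Type*} [Fintype ι] {k : ℕ} (x : ι → ℝ)
    (W : ι → Matrix (Fin k) (Fin k) ℂ) {s : Set ℝ} (hs : MeasurableSet s) :
    atomicMeasure x W s = ∑ j, s.indicator (fun _ => (1 : ℂ)) (x j) • W j := by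
  classical
  have h : ∀ t : Finset ι, (∑ j ∈ t, VectorMeasure.dirac (x j) (W j)) s
      = ∑ j ∈ t, VectorMeasure.dirac (x j) (W j) s := by
    intro t
    induction t using Finset.induction_on with
    | empty => simp
    | insert a t ha ih => rw [Finset.sum_insert ha, Finset.sum_insert ha,
        add_apply, ih]
  rw [atomicMeasure, h]
  refine Finset.sum_congr rfl fun j _ => ?_
  by_cases hj : x j ∈ s
  · simp [hs, hj]
  · simp [hj]

/-- Integrating a function against a finite atomic measure only involves the masses of points. -/
theorem sum_smul_eq_sum_atomicMeasure_singleton {ι : Type*} [Fintype ι] {k : ℕ} (x : ι → ℝ)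
    (W : ι → Matrix (Fin k) (Fin k) ℂ) (h : ℝ → ℂ) (T : Finset ℝ) (hT : ∀ j, x j ∈ T) :
    ∑ j, h (x j) • W j = ∑ y ∈ T, h y • atomicMeasure x W {y} := by
  classical
  simp_rw [atomicMeasure_apply x W (MeasurableSet.singleton _), Finset.smul_sum]
  rw [Finset.sum_comm]
  refine Finset.sum_congr rfl fun j _ => ?_
  rw [Finset.sum_eq_single (x j)]
  · simp
  · intro y _ hy
    simp [Set.indicator_of_notMem (s := {y}) (a := x j) (by simpa using hy.symm)]
  · intro hj
    exact absurd (hT j) hj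

/-- Finite atomic measures agree if and only if all their moments agree. -/
theorem atomicMeasure_eq_iff_moments {ι κ : Type*} [Fintype ι] [Fintype κ] {k : ℕ}
    (x : ι → ℝ) (W : ι → Matrix (Fin k) (Fin k) ℂ) (y : κ → ℝ)
    (Z : κ → Matrix (Fin k) (Fin k) ℂ) :
    atomicMeasure x W = atomicMeasure y Z ↔
      ∀ i : ℕ, ∑ j, (x j : ℂ) ^ i • W j = ∑ j, (y j : ℂ) ^ i • Z j := by
  classical
  set T : Finset ℝ := Finset.univ.image x ∪ Finset.univ.image y with hT
  have hx : ∀ j, x j ∈ T := fun j => by simp [hT]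
  have hy : ∀ j, y j ∈ T := fun j => by simp [hT]
  constructor
  · intro h i
    rw [sum_smul_eq_sum_atomicMeasure_singleton x W (fun t => (t : ℂ) ^ i) T hx, h,
      sum_smul_eq_sum_atomicMeasure_singleton y Z (fun t => (t : ℂ) ^ i) T hy]
  · intro h
    have hpoly : ∀ P : Polynomial ℂ,
        ∑ j, P.eval (x j : ℂ) • W j = ∑ j, P.eval (y j : ℂ) • Z j := by
      intro P
      simp_rw [Polynomial.eval_eq_sum_range, Finset.sum_smul]
      rw [Finset.sum_comm, Finset.sum_comm (s := (Finset.univ : Finset κ))]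
      refine Finset.sum_congr rfl fun i _ => ?_
      simp_rw [mul_smul, ← Finset.smul_sum, h i]
    ext1 s hs
    rw [atomicMeasure_apply x W hs, atomicMeasure_apply y Z hs]
    -- On the finite set of all atoms of both measures, the indicator of `s` agrees with a
    -- polynomial, so equality against polynomials suffices.
    have hnode : ∀ t ∈ T, (Lagrange.interpolate T (fun t : ℝ => (t : ℂ))
        (s.indicator fun _ => (1 : ℂ))).eval (t : ℂ) = s.indicator (fun _ => (1 : ℂ)) t :=
      fun t ht => Lagrange.eval_interpolate_at_node (v := fun t : ℝ => (t : ℂ)) _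
        (Complex.ofReal_injective.injOn) ht
    have := hpoly (Lagrange.interpolate T (fun t : ℝ => (t : ℂ)) (s.indicator fun _ => (1 : ℂ)))
    simpa only [hnode _ (hx _), hnode _ (hy _)] using this

/-- The moments of the spectral measure of `J` are the leading `k × k` blocks of its powers. -/
theorem moments_spectralMeasure {k N : ℕ} (hkN : k ≤ N) (J : Matrix (Fin N) (Fin N) ℂ)
    (hJ : J.IsHermitian) (i : ℕ) :
    (∑ j, (hJ.eigenvalues j : ℂ) ^ i •
      Matrix.vecMulVec (fun a : Fin k => hJ.eigenvectorBasis j (Fin.castLE hkN a))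
        (star fun a : Fin k => hJ.eigenvectorBasis j (Fin.castLE hkN a))) =
      (J ^ i).submatrix (Fin.castLE hkN) (Fin.castLE hkN) := by
  have hpow : J ^ i = (hJ.eigenvectorUnitary : Matrix (Fin N) (Fin N) ℂ) *
      Matrix.diagonal (fun j => (hJ.eigenvalues j : ℂ) ^ i) *
        star (hJ.eigenvectorUnitary : Matrix (Fin N) (Fin N) ℂ) := by
    conv_lhs => rw [hJ.spectral_theorem, ← map_pow, Matrix.diagonal_pow]
    rw [Unitary.conjStarAlgAut_apply]
    rfl
  ext a b
  rw [hpow, Matrix.sum_apply, Matrix.submatrix_apply, Matrix.mul_apply]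
  refine Finset.sum_congr rfl fun j _ => ?_
  simp only [Matrix.smul_apply, Matrix.vecMulVec_apply, smul_eq_mul, Matrix.mul_diagonal,
    Matrix.star_apply, Pi.star_apply, Matrix.IsHermitian.eigenvectorUnitary_apply]
  ring

theorem moments_eq_stackedMatrix {m k : ℕ} {n : Fin m → ℕ} (x : Fin m → ℝ)
    (V : ∀ j, Matrix (Fin k) (Fin (n j)) ℂ) (i : ℕ) :
    ∑ j, (x j : ℂ) ^ i • (V j * (V j)ᴴ) =
      (stackedMatrix V)ᴴ * pointMatrix n x ^ i * stackedMatrix V := by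
  ext a b
  rw [Matrix.sum_apply, pointMatrix, Matrix.diagonal_pow, Matrix.mul_apply, Fintype.sum_sigma]
  refine Finset.sum_congr rfl fun j _ => ?_
  rw [Matrix.smul_apply, Matrix.mul_apply, smul_eq_mul, Finset.mul_sum]
  refine Finset.sum_congr rfl fun y _ => ?_
  rw [Matrix.mul_diagonal, stackedMatrix, Matrix.conjTranspose_conjTranspose]
  simp only [Matrix.conjTranspose_apply, Matrix.of_apply, Pi.pow_apply]
  ring

/-- A spectral measure equals `∑ j, V_j V_j^* δ_{x_j}` if and only if the moments agree. -/
theorem spectralMeasure_eq_iff_moments {m k N : ℕ} {n : Fin m → ℕ} (hkN : k ≤ N)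
    (J : Matrix (Fin N) (Fin N) ℂ) (hJ : J.IsHermitian) (x : Fin m → ℝ)
    (V : ∀ j, Matrix (Fin k) (Fin (n j)) ℂ) :
    spectralMeasure hkN J hJ = atomicMeasure x (fun j => V j * (V j)ᴴ) ↔
      ∀ i : ℕ, (J ^ i).submatrix (Fin.castLE hkN) (Fin.castLE hkN) =
        (stackedMatrix V)ᴴ * pointMatrix n x ^ i * stackedMatrix V := by
  rw [spectralMeasure, atomicMeasure_eq_iff_moments]
  refine forall_congr' fun i => ?_
  rw [moments_eq_stackedMatrix, ← moments_spectralMeasure hkN J hJ i]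

/-! ### Block Krylov matrices -/

/-- The block Krylov matrix `[B, A B, …, A^d B]`. -/
def blockKrylov {ι : Type*} [Fintype ι] [DecidableEq ι] {k : ℕ} (A : Matrix ι ι ℂ)
    (B : Matrix ι (Fin k) ℂ) (d : ℕ) : Matrix ι (Fin (d + 1) × Fin k) ℂ :=
  Matrix.of fun p c => (A ^ (c.1 : ℕ) * B) p c.2

theorem krylovMatrix_eq_blockKrylov {m k : ℕ} {n : Fin m → ℕ} (x : Fin m → ℝ)
    (V : ∀ j, Matrix (Fin k) (Fin (n j)) ℂ) (d : ℕ) :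
    krylovMatrix x V d = blockKrylov (pointMatrix n x) (stackedMatrix V) d := rfl

theorem conjTranspose_blockKrylov_mul_self {ι : Type*} [Fintype ι] [DecidableEq ι] {k : ℕ}
    {A : Matrix ι ι ℂ} (hA : A.IsHermitian) (B : Matrix ι (Fin k) ℂ) (d : ℕ) :
    (blockKrylov A B d)ᴴ * blockKrylov A B d =
      Matrix.of fun c c' => (Bᴴ * A ^ ((c.1 : ℕ) + (c'.1 : ℕ)) * B) c.2 c'.2 := by
  ext c c'
  have h : Bᴴ * A ^ ((c.1 : ℕ) + (c'.1 : ℕ)) * B =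
      (A ^ (c.1 : ℕ) * B)ᴴ * (A ^ (c'.1 : ℕ) * B) := by
    rw [Matrix.conjTranspose_mul, Matrix.conjTranspose_pow, hA.eq, pow_add]
    simp only [Matrix.mul_assoc]
  rw [Matrix.of_apply, h, Matrix.mul_apply, Matrix.mul_apply]
  rfl

/-- A matrix has the rank of its Gram matrix, and for Hermitian `A` the Gram matrix here has blocks
`Bᴴ * A ^ (i + j) * B`. -/
theorem rank_blockKrylov_eq_of_moments {ι κ : Type*} [Fintype ι] [DecidableEq ι] [Fintype κ]
    [DecidableEq κ] {k : ℕ} {A : Matrix ι ι ℂ} (hA : A.IsHermitian) (B : Matrix ι (Fin k) ℂ)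
    {A' : Matrix κ κ ℂ} (hA' : A'.IsHermitian) (B' : Matrix κ (Fin k) ℂ)
    (h : ∀ i : ℕ, Bᴴ * A ^ i * B = B'ᴴ * A' ^ i * B') (d : ℕ) :
    (blockKrylov A B d).rank = (blockKrylov A' B' d).rank := by
  rw [← Matrix.rank_conjTranspose_mul_self, conjTranspose_blockKrylov_mul_self hA,
    ← Matrix.rank_conjTranspose_mul_self (blockKrylov A' B' d),
    conjTranspose_blockKrylov_mul_self hA']
  simp_rw [h]

theorem isHermitian_pointMatrix {m : ℕ} (n : Fin m → ℕ) (x : Fin m → ℝ) :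
    (pointMatrix n x).IsHermitian := by
  rw [pointMatrix, Matrix.IsHermitian, Matrix.diagonal_conjTranspose]
  congr 1
  ext p
  simp

/-- The first `k` columns of the identity matrix. -/
def firstColumns {k N : ℕ} (hkN : k ≤ N) : Matrix (Fin N) (Fin k) ℂ :=
  (1 : Matrix (Fin N) (Fin N) ℂ).submatrix id (Fin.castLE hkN)

theorem conjTranspose_firstColumns_mul_mul {k N : ℕ} (hkN : k ≤ N)
    (A : Matrix (Fin N) (Fin N) ℂ) :
    (firstColumns hkN)ᴴ * A * firstColumns hkN =
      A.submatrix (Fin.castLE hkN) (Fin.castLE hkN) := by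
  ext a b
  simp [firstColumns, Matrix.mul_apply, Matrix.one_apply]

/-! ### Banded matrices have Krylov matrices of full rank -/

theorem lt_ceilDiv_iff_mul_lt {k : ℕ} (hk : 1 ≤ k) (N b : ℕ) : b < N ⌈/⌉ k ↔ b * k < N := by
  rw [← not_le, ceilDiv_le_iff_le_mul (by omega), not_le, mul_comm]

theorem blockSize_eq_of_succ_mul_le {k N b : ℕ} (h : (b + 1) * k ≤ N) : blockSize k N b = k := by
  rw [add_mul, one_mul] at h
  unfold blockSize
  omega

theorem surjective_mulVec_of_hasFullRank {p q : Type*} [Fintype p] [Fintype q]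
    {M : Matrix p q ℂ} (h : HasFullRank M) (hpq : Fintype.card p ≤ Fintype.card q) :
    Function.Surjective M.mulVec := by
  have hr : Module.finrank ℂ (LinearMap.range M.mulVecLin) = Module.finrank ℂ (p → ℂ) := by
    rw [Module.finrank_fintype_fun_eq_card]
    exact h.trans (min_eq_left hpq)
  have htop := Submodule.eq_top_of_finrank_eq hr
  exact LinearMap.range_eq_top.mp htop

/-- The span of the columns of `[B, A B, …, A^d B]`. -/
def krylovSpace {ι : Type*} [Fintype ι] [DecidableEq ι] {k : ℕ} (A : Matrix ι ι ℂ)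
    (B : Matrix ι (Fin k) ℂ) (d : ℕ) : Submodule ℂ (ι → ℂ) :=
  Submodule.span ℂ (Set.range (blockKrylov A B d).col)

section KrylovSpace

variable {ι : Type*} [Fintype ι] [DecidableEq ι] {k : ℕ} (A : Matrix ι ι ℂ)
  (B : Matrix ι (Fin k) ℂ)

theorem pow_mul_col_mem_krylovSpace {a d : ℕ} (h : a ≤ d) (c : Fin k) :
    (A ^ a * B).col c ∈ krylovSpace A B d :=
  Submodule.subset_span ⟨(⟨a, by omega⟩, c), rfl⟩

theorem krylovSpace_le_succ (d : ℕ) : krylovSpace A B d ≤ krylovSpace A B (d + 1) := by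
  rw [krylovSpace, Submodule.span_le]
  rintro _ ⟨⟨a, c⟩, rfl⟩
  exact pow_mul_col_mem_krylovSpace A B (by omega) c

theorem mulVec_mem_krylovSpace_succ {d : ℕ} {u : ι → ℂ} (hu : u ∈ krylovSpace A B d) :
    A *ᵥ u ∈ krylovSpace A B (d + 1) := by
  have h : krylovSpace A B d ≤ (krylovSpace A B (d + 1)).comap A.mulVecLin := by
    rw [krylovSpace, Submodule.span_le]
    rintro _ ⟨⟨a, c⟩, rfl⟩
    have h1 := pow_mul_col_mem_krylovSpace A B (a := a + 1) (d := d + 1) (by omega) c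
    have h2 : (A ^ ((a : ℕ) + 1) * B).col c = A *ᵥ (A ^ (a : ℕ) * B).col c := by
      rw [pow_succ', Matrix.mul_assoc]
      rfl
    rw [h2] at h1
    exact h1
  exact h hu

end KrylovSpace

/-- The Krylov space of order `d` of a banded matrix contains the first `(d + 1) k` coordinate
vectors. -/
theorem IsBanded.single_mem_krylovSpace {k N : ℕ} (hk : 1 ≤ k) (hkN : k ≤ N)
    {J : Matrix (Fin N) (Fin N) ℂ} (hJ : IsBanded k N J) (d : ℕ) (i : Fin N)
    (hi : (i : ℕ) < (d + 1) * k) :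
    Pi.single i (1 : ℂ) ∈ krylovSpace J (firstColumns hkN) d := by
  induction d generalizing i with
  | zero =>
    rw [zero_add, one_mul] at hi
    have h := pow_mul_col_mem_krylovSpace J (firstColumns hkN) (le_refl 0) ⟨i, hi⟩
    convert h using 1
    ext p
    rw [pow_zero, Matrix.one_mul, Matrix.col_apply, firstColumns, Matrix.submatrix_apply,
      Matrix.one_apply, Pi.single_apply]
    rfl
  | succ d ih =>
    by_cases hid : (i : ℕ) < (d + 1) * k
    · exact krylovSpace_le_succ _ _ _ (ih i hid)
    push Not at hid
    have hbig : (d + 1) * k < N := hid.trans_lt i.isLt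
    -- Since `i` lies beyond block `d`, that block has full length `k`; the subdiagonal block below
    -- it is at least as wide as tall, so full rank means surjective.
    have hsize := blockSize_eq_of_succ_mul_le hbig.le
    have hceil : d + 1 < N ⌈/⌉ k := (lt_ceilDiv_iff_mul_lt hk N (d + 1)).2 hbig
    have hi' : (i : ℕ) < (d + 1) * k + k := by linarith
    have hr : (i : ℕ) - (d + 1) * k < blockSize k N (d + 1) := by
      have := i.isLt
      unfold blockSize
      omega
    obtain ⟨w, hw⟩ := surjective_mulVec_of_hasFullRank (hJ.fullRank d hceil)
      (by simp only [Fintype.card_fin, hsize]; exact min_le_left _ _)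
      (Pi.single ⟨(i : ℕ) - (d + 1) * k, hr⟩ 1)
    set u : Fin N → ℂ := ∑ c, w c • Pi.single (blockIndex k N d c) (1 : ℂ) with hu_def
    have hu : u ∈ krylovSpace J (firstColumns hkN) d := by
      refine Submodule.sum_mem _ fun c _ => Submodule.smul_mem _ _ (ih _ ?_)
      have := c.isLt
      have h2 := add_mul d 1 k
      simp only [blockIndex]
      omega
    have hJu : ∀ p, (J *ᵥ u) p = ∑ c, J p (blockIndex k N d c) * w c := by
      intro p
      rw [hu_def, Matrix.mulVec_sum, Finset.sum_apply]
      refine Finset.sum_congr rfl fun c _ => ?_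
      rw [Matrix.mulVec_smul, Matrix.mulVec_single_one, Pi.smul_apply, smul_eq_mul, mul_comm]
      rfl
    -- In block `d + 1` this is the choice of `w`; further down, both sides vanish because `J` is
    -- block tridiagonal.
    have hhigh : ∀ p : Fin N, (d + 1) * k ≤ (p : ℕ) →
        (J *ᵥ u) p = (Pi.single i (1 : ℂ) : Fin N → ℂ) p := by
      intro p hp
      rw [hJu]
      by_cases hp2 : (p : ℕ) < (d + 1) * k + k
      · have hr' : (p : ℕ) - (d + 1) * k < blockSize k N (d + 1) := by
          have := p.isLt
          unfold blockSize
          omega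
        have hpb : blockIndex k N (d + 1) ⟨(p : ℕ) - (d + 1) * k, hr'⟩ = p := by
          ext
          simp only [blockIndex]
          omega
        have h := congrFun hw ⟨(p : ℕ) - (d + 1) * k, hr'⟩
        have hiff : (⟨(p : ℕ) - (d + 1) * k, hr'⟩ : Fin (blockSize k N (d + 1))) =
            ⟨(i : ℕ) - (d + 1) * k, hr⟩ ↔ p = i := by
          rw [Fin.mk.injEq, Fin.ext_iff]
          omega
        rw [Pi.single_apply, if_congr hiff rfl rfl, ← Pi.single_apply] at h
        rw [← h]
        simp only [Matrix.mulVec, dotProduct, block, Matrix.submatrix_apply, hpb]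
      · push Not at hp2
        rw [Pi.single_eq_of_ne (by rintro rfl; omega)]
        refine Finset.sum_eq_zero fun c _ => ?_
        have hdm := Nat.div_add_mod (p : ℕ) k
        have hmod := Nat.mod_lt (p : ℕ) (by omega : 0 < k)
        have hdiv : d + 1 < (p : ℕ) / k :=
          (Nat.le_div_iff_mul_le (by omega)).2 (by linarith [add_mul (d + 1) 1 k])
        have hmul : (p : ℕ) / k * k = k * ((p : ℕ) / k) := mul_comm _ _
        have hpN := p.isLt
        have hrow : (p : ℕ) % k < blockSize k N ((p : ℕ) / k) := by
          unfold blockSize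
          omega
        have hz := hJ.tridiagonal ((p : ℕ) / k)
          ((lt_ceilDiv_iff_mul_lt hk N _).2 (by omega)) d (by omega) (Or.inr hdiv)
        have hpb : blockIndex k N ((p : ℕ) / k) ⟨(p : ℕ) % k, hrow⟩ = p := by
          ext
          simp only [blockIndex]
          omega
        have h := congrFun (congrFun hz ⟨(p : ℕ) % k, hrow⟩) c
        simp only [block, Matrix.submatrix_apply, hpb, Matrix.zero_apply] at h
        rw [h, zero_mul]
    -- The error of `J *ᵥ u` sits in the first `(d + 1) * k` coordinates, which the induction
    -- hypothesis covers.
    have hdecomp : Pi.single i (1 : ℂ) = J *ᵥ u -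
        ∑ p ∈ Finset.univ.filter (fun p : Fin N => (p : ℕ) < (d + 1) * k),
          (J *ᵥ u) p • Pi.single p (1 : ℂ) := by
      ext p
      rw [Pi.sub_apply, Finset.sum_apply]
      simp only [Pi.smul_apply, Pi.single_apply _ _ p, smul_eq_mul, mul_ite, mul_one, mul_zero,
        Finset.sum_ite_eq, Finset.mem_filter, Finset.mem_univ, true_and]
      by_cases h : (p : ℕ) < (d + 1) * k
      · rw [if_pos h, sub_self, if_neg]
        rintro rfl
        omega
      · rw [if_neg h, hhigh p (by omega), sub_zero, Pi.single_apply]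
    rw [hdecomp]
    refine Submodule.sub_mem _ (mulVec_mem_krylovSpace_succ _ _ hu)
      (Submodule.sum_mem _ fun p hp => Submodule.smul_mem _ _ ?_)
    exact krylovSpace_le_succ _ _ _ (ih p (by simpa using hp))

theorem rank_le_min_card {p q : Type*} [Fintype p] [Fintype q] (M : Matrix p q ℂ) :
    M.rank ≤ min (Fintype.card p) (Fintype.card q) :=
  le_min M.rank_le_card_height M.rank_le_card_width

theorem IsBanded.hasFullRank_blockKrylov {k N : ℕ} (hk : 1 ≤ k) (hkN : k ≤ N)
    {J : Matrix (Fin N) (Fin N) ℂ} (hJ : IsBanded k N J) (d : ℕ) :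
    HasFullRank (blockKrylov J (firstColumns hkN) d) := by
  refine le_antisymm (rank_le_min_card _) ?_
  rw [Matrix.rank_eq_finrank_span_cols]
  simp only [Fintype.card_fin, Fintype.card_prod]
  have hli : LinearIndependent ℂ (fun i : Fin (min N ((d + 1) * k)) =>
      (Pi.single (Fin.castLE (min_le_left _ _) i) (1 : ℂ) : Fin N → ℂ)) :=
    (Pi.linearIndependent_single_one (Fin N) ℂ).comp _ (Fin.castLE_injective _)
  have hcard := finrank_span_eq_card hli
  rw [Fintype.card_fin] at hcard
  rw [← hcard]
  refine Submodule.finrank_mono (Submodule.span_le.2 ?_)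
  rintro _ ⟨i, rfl⟩
  refine hJ.single_mem_krylovSpace hk hkN d _ ?_
  have := i.isLt
  simp only [Fin.val_castLE]
  omega

/-! ### Matrices in echelon form with a pivot in every row -/

section Echelon

variable {a b : ℕ} {M : Matrix (Fin a) (Fin b) ℂ} {π : Fin a → Fin b}

/-- The pivot columns form a square upper triangular matrix with nonzero diagonal. -/
theorem hasFullRank_of_pivots (hπ : StrictMono π) (hz : ∀ r c, c < π r → M r c = 0)
    (hpos : ∀ r, 0 < M r (π r)) : HasFullRank M := by
  refine le_antisymm (rank_le_min_card M) ((min_le_left _ _).trans ?_)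
  have htri : (M.submatrix id π).IsUpperTriangular := fun i j hij => hz _ _ (hπ hij)
  have hdet : IsUnit (M.submatrix id π).det := by
    rw [Matrix.det_of_isUpperTriangular htri, isUnit_iff_ne_zero, Finset.prod_ne_zero_iff]
    exact fun r _ => (hpos r).ne'
  rw [← Matrix.rank_of_isUnit _ ((Matrix.isUnit_iff_isUnit_det _).2 hdet)]
  exact Matrix.rank_submatrix_le M id π

theorem isRowEchelon_of_pivots (hπ : StrictMono π) (hz : ∀ r c, c < π r → M r c = 0)
    (hpos : ∀ r, 0 < M r (π r)) : M.IsRowEchelon := by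
  intro i₁ i₂ hi j₂ hj
  have hle : j₂ ≤ π i₁ := not_lt.1 fun h => (hpos i₁).ne' (hj _ h)
  exact hz _ _ (hle.trans_lt (hπ hi))

theorem pos_of_isLeadingEntry_of_pivots (hz : ∀ r c, c < π r → M r c = 0)
    (hpos : ∀ r, 0 < M r (π r)) {r : Fin a} {c : Fin b} (h : M.IsLeadingEntry r c) :
    0 < M r c := by
  rcases lt_trichotomy c (π r) with hc | rfl | hc
  · exact absurd (hz r c hc) h.2
  · exact hpos r
  · exact absurd (h.1 _ hc) (hpos r).ne'

end Echelon

/-- A Hermitian matrix is banded if row `r` of it has its first nonzero entry, a positive one, in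
the column `c` with `p c + k = p r`, for a suitable increasing sequence `p`. -/
theorem isBanded_of_profile {k N : ℕ} (hk : 1 ≤ k) {J : Matrix (Fin N) (Fin N) ℂ}
    (hJ : J.IsHermitian) {p : Fin N → ℕ} (hp : StrictMono p) (hle : ∀ s : Fin N, (s : ℕ) ≤ p s)
    (hlt : ∀ s, p s < N ⌈/⌉ k * k)
    (hinit : ∀ j, j + 1 < N ⌈/⌉ k → ∀ s : Fin N, (s : ℕ) < (j + 1) * k → p s = s)
    (hzero : ∀ r c, p c + k < p r → J r c = 0)
    (hpos : ∀ r c, p r = p c + k → 0 < J r c) : IsBanded k N J := by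
  -- For `c` in block `b` and `r` in block `a`: `p c + k = c + k < (b + 2) * k ≤ a * k ≤ r ≤ p r`.
  have hlower : ∀ a b, b + 1 < a → a < N ⌈/⌉ k → block (k := k) J a b = 0 := by
    intro a b hab ha
    ext r c
    refine hzero _ _ ?_
    have hc : (blockIndex k N b c : ℕ) < (b + 1) * k := by
      have h1 := c.isLt
      have h2 := add_mul b 1 k
      simp only [blockIndex]
      unfold blockSize at h1
      omega
    rw [hinit b (by omega) _ hc]
    refine lt_of_lt_of_le ?_ (hle _)
    have h3 : (b + 2) * k ≤ a * k := Nat.mul_le_mul_right k hab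
    have h4 : (blockIndex k N a r : ℕ) = a * k + r := rfl
    have h5 := add_mul b 1 k
    have h6 := add_mul b 2 k
    omega
  have hstart : ∀ j, j + 1 < N ⌈/⌉ k → ∀ r : Fin (blockSize k N (j + 1)),
      (j + 1) * k + r ≤ p (blockIndex k N (j + 1) r) ∧
        p (blockIndex k N (j + 1) r) < (j + 2) * k := by
    intro j hj r
    refine ⟨hle (blockIndex k N (j + 1) r), ?_⟩
    by_cases hj2 : j + 2 < N ⌈/⌉ k
    · have hr : (blockIndex k N (j + 1) r : ℕ) < (j + 1 + 1) * k := by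
        have h1 := r.isLt
        have h2 := add_mul (j + 1) 1 k
        simp only [blockIndex]
        unfold blockSize at h1
        omega
      rw [hinit (j + 1) hj2 _ hr]
      exact hr
    · have h : N ⌈/⌉ k = j + 2 := by omega
      have h2 := hlt (blockIndex k N (j + 1) r)
      rwa [h] at h2
  have hsize : ∀ j, j + 1 < N ⌈/⌉ k → blockSize k N j = k := fun j hj =>
    blockSize_eq_of_succ_mul_le ((lt_ceilDiv_iff_mul_lt hk N (j + 1)).1 hj).le
  have hcol : ∀ j, j + 1 < N ⌈/⌉ k → ∀ c : Fin (blockSize k N j),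
      p (blockIndex k N j c) = j * k + c := by
    intro j hj c
    refine hinit j hj _ ?_
    have h1 := c.isLt.trans_eq (hsize j hj)
    have h2 := add_mul j 1 k
    simp only [blockIndex]
    omega
  have hpivot : ∀ j, j + 1 < N ⌈/⌉ k →
      ∃ π : Fin (blockSize k N (j + 1)) → Fin (blockSize k N j), StrictMono π ∧
        (∀ r, (π r : ℕ) + (j + 1) * k = p (blockIndex k N (j + 1) r)) ∧
        (∀ r c, c < π r → block (k := k) J (j + 1) j r c = 0) ∧
        ∀ r, 0 < block (k := k) J (j + 1) j r (π r) := by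
    intro j hj
    have e1 := add_mul j 1 k
    have e2 := add_mul j 2 k
    -- Columns of block `j` satisfy `p c = j * k + c`, so the pivot equation `p c + k = p r` has the
    -- solution `c = p r - (j + 1) * k`, which `hstart` places inside the block.
    let π : Fin (blockSize k N (j + 1)) → Fin (blockSize k N j) := fun r =>
      ⟨p (blockIndex k N (j + 1) r) - (j + 1) * k, by
        have := hstart j hj r
        rw [hsize j hj]
        omega⟩
    have hπ : ∀ r, (π r : ℕ) + (j + 1) * k = p (blockIndex k N (j + 1) r) := by
      intro r
      have := hstart j hj r
      simp only [π]
      omega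
    refine ⟨π, ?_, hπ, ?_, ?_⟩
    · intro r r' hrr
      have h : p (blockIndex k N (j + 1) r) < p (blockIndex k N (j + 1) r') := by
        refine hp ?_
        rw [Fin.lt_def] at hrr ⊢
        simp only [blockIndex]
        omega
      rw [← hπ r, ← hπ r'] at h
      rw [Fin.lt_def]
      omega
    · intro r c hc
      refine hzero _ _ ?_
      rw [hcol j hj, ← hπ r]
      rw [Fin.lt_def] at hc
      omega
    · intro r
      refine hpos _ _ ?_
      rw [hcol j hj, ← hπ r]
      omega
  refine ⟨hJ, fun j _ => hJ.submatrix _, ?_, ?_, ?_, ?_, ?_, ?_⟩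
  · rintro a ha b hb (hab | hab)
    · have h := hlower b a hab hb
      have h2 : block (k := k) J a b = (block (k := k) J b a)ᴴ := by
        rw [block, block, Matrix.conjTranspose_submatrix, hJ.eq]
      rw [h2, h, Matrix.conjTranspose_zero]
    · exact hlower a b hab ha
  · intro j hj
    obtain ⟨π, hmono, -, hz, hpos'⟩ := hpivot j hj
    exact hasFullRank_of_pivots hmono hz hpos'
  · intro j hj r c hcr
    refine hzero _ _ ?_
    have h1 := (hstart j (by omega) r).1
    rw [hcol j (by omega)]
    have e1 := add_mul j 1 k
    omega
  · intro j hj r c hrc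
    refine hpos _ _ ?_
    rw [hcol j (by omega), hcol (j + 1) (by omega)]
    have e1 := add_mul j 1 k
    omega
  · intro j hj
    obtain ⟨π, hmono, -, hz, hpos'⟩ := hpivot j (by omega)
    exact isRowEchelon_of_pivots hmono hz hpos'
  · intro j hj r c hrc
    obtain ⟨π, -, -, hz, hpos'⟩ := hpivot j (by omega)
    exact pos_of_isLeadingEntry_of_pivots hz hpos' hrc

/-! ### Gram–Schmidt orthonormalization along a sequence -/

section GramSchmidt

open InnerProductSpace

variable {E : Type*} [NormedAddCommGroup E] [InnerProductSpace ℂ E] (f : ℕ → E)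

theorem gramSchmidtNormed_mem_span_succ (t : ℕ) :
    gramSchmidtNormed ℂ f t ∈ Submodule.span ℂ (f '' Set.Iio (t + 1)) := by
  rw [gramSchmidtNormed]
  refine Submodule.smul_mem _ _ ?_
  rw [← span_gramSchmidt_Iio ℂ f (t + 1)]
  exact Submodule.subset_span ⟨t, by simp, rfl⟩

theorem inner_gramSchmidt_eq_zero_of_mem_span {s t : ℕ} (hts : t ≤ s) {v : E}
    (hv : v ∈ Submodule.span ℂ (f '' Set.Iio t)) : inner ℂ (gramSchmidt ℂ f s) v = 0 := by
  rw [← span_gramSchmidt_Iio ℂ f t] at hv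
  induction hv using Submodule.span_induction with
  | mem v hv =>
    obtain ⟨i, hi, rfl⟩ := hv
    rw [Set.mem_Iio] at hi
    exact gramSchmidt_orthogonal ℂ f (by omega)
  | zero => exact inner_zero_right _
  | add v w _ _ hv hw => rw [inner_add_right, hv, hw, add_zero]
  | smul a v _ hv => rw [inner_smul_right, hv, mul_zero]

theorem inner_gramSchmidtNormed_eq_zero_of_mem_span {s t : ℕ} (hts : t ≤ s) {v : E}
    (hv : v ∈ Submodule.span ℂ (f '' Set.Iio t)) :
    inner ℂ (gramSchmidtNormed ℂ f s) v = 0 := by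
  rw [gramSchmidtNormed, inner_smul_left, inner_gramSchmidt_eq_zero_of_mem_span f hts hv, mul_zero]

theorem sub_gramSchmidt_mem_span (t : ℕ) :
    f t - gramSchmidt ℂ f t ∈ Submodule.span ℂ (f '' Set.Iio t) := by
  have h := gramSchmidt_def' ℂ f t
  have h2 : f t - gramSchmidt ℂ f t =
      ∑ i ∈ Finset.Iio t, (ℂ ∙ gramSchmidt ℂ f i).starProjection (f t) := by
    rw [sub_eq_iff_eq_add']
    exact h
  rw [h2, ← span_gramSchmidt_Iio ℂ f t]
  refine Submodule.sum_mem _ fun i hi => ?_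
  have hle : (ℂ ∙ gramSchmidt ℂ f i) ≤ Submodule.span ℂ (gramSchmidt ℂ f '' Set.Iio t) :=
    Submodule.span_mono (by
      rw [Set.singleton_subset_iff]
      exact ⟨i, by simpa using hi, rfl⟩)
  exact hle (Submodule.starProjection_apply_mem _ _)

theorem inner_gramSchmidtNormed_self (t : ℕ) :
    inner ℂ (gramSchmidtNormed ℂ f t) (f t) = (‖gramSchmidt ℂ f t‖ : ℂ) := by
  have h : f t = (f t - gramSchmidt ℂ f t) + gramSchmidt ℂ f t := by abel
  rw [h, inner_add_right,
    inner_gramSchmidtNormed_eq_zero_of_mem_span f le_rfl (sub_gramSchmidt_mem_span f t),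
    zero_add, gramSchmidtNormed, inner_smul_left, inner_self_eq_norm_sq_to_K]
  -- If the Gram–Schmidt vector is zero, so is its normalization, and both sides vanish.
  by_cases h0 : ‖gramSchmidt ℂ f t‖ = 0
  · simp [h0]
  · have : (‖gramSchmidt ℂ f t‖ : ℂ) ≠ 0 := by exact_mod_cast h0
    simp only [Complex.coe_algebraMap, map_inv₀, Complex.conj_ofReal]
    field_simp

theorem gramSchmidtNormed_ne_zero_iff (t : ℕ) :
    gramSchmidtNormed ℂ f t ≠ 0 ↔ gramSchmidt ℂ f t ≠ 0 := by
  simp [gramSchmidtNormed]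

/-- Vectors that are orthonormal from the start are kept. -/
theorem gramSchmidtNormed_eq_self_of_orthonormal {t : ℕ} (hnorm : ‖f t‖ = 1)
    (horth : ∀ i < t, inner ℂ (f i) (f t) = 0) : gramSchmidtNormed ℂ f t = f t := by
  have hspan : ∀ v ∈ Submodule.span ℂ (f '' Set.Iio t), inner ℂ v (f t) = 0 := by
    intro v hv
    induction hv using Submodule.span_induction with
    | mem v hv =>
      obtain ⟨i, hi, rfl⟩ := hv
      exact horth i hi
    | zero => exact inner_zero_left _
    | add v w _ _ hv hw => rw [inner_add_left, hv, hw, add_zero]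
    | smul a v _ hv => rw [inner_smul_left, hv, mul_zero]
  have hmem := sub_gramSchmidt_mem_span f t
  have h1 := hspan _ hmem
  have h2 := inner_eq_zero_symm.1 (inner_gramSchmidt_eq_zero_of_mem_span f le_rfl hmem)
  -- The difference lies in the span of the earlier vectors, to which both terms are orthogonal;
  -- hence it is orthogonal to itself.
  have h3 : f t - gramSchmidt ℂ f t = 0 := by
    rw [← inner_self_eq_zero (𝕜 := ℂ), inner_sub_right, h1, h2, sub_zero]
  have h4 : gramSchmidt ℂ f t = f t := (sub_eq_zero.1 h3).symm
  rw [gramSchmidtNormed, h4, hnorm]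
  simp

/-- The nonzero Gram–Schmidt vectors of a spanning finite part of a sequence, enumerated
increasingly, form an orthonormal basis. -/
theorem exists_orthonormalBasis_gramSchmidtNormed [FiniteDimensional ℂ E] {N L : ℕ}
    (hN : Module.finrank ℂ E = N) (hspan : Submodule.span ℂ (f '' Set.Iio L) = ⊤) :
    ∃ (q : OrthonormalBasis (Fin N) ℂ E) (p : Fin N → ℕ), StrictMono p ∧
      (∀ s : Fin N, (s : ℕ) ≤ p s) ∧ (∀ s, p s < L) ∧
      (∀ s, q s = gramSchmidtNormed ℂ f (p s)) ∧ (∀ s, gramSchmidtNormed ℂ f (p s) ≠ 0) ∧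
      ∀ s : Fin N, (∀ t ≤ (s : ℕ), gramSchmidtNormed ℂ f t ≠ 0) → p s = s := by
  classical
  set P : ℕ → Prop := fun t => t < L ∧ gramSchmidtNormed ℂ f t ≠ 0 with hP
  have hf : (Set.ofPred P).Finite := (Set.finite_Iio L).subset fun t ht => ht.1
  have hon : Orthonormal ℂ fun t : {t // P t} => gramSchmidtNormed ℂ f t :=
    (gramSchmidtNormed_orthonormal' (𝕜 := ℂ) f).comp
      (fun t : {t // P t} => ⟨t, t.2.2⟩) fun a b h => by
        simpa [Subtype.ext_iff] using h
  have : Fintype {t // P t} := hf.fintype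
  have hsp : Submodule.span ℂ (Set.range fun t : {t // P t} => gramSchmidtNormed ℂ f t) = ⊤ := by
    rw [eq_top_iff, ← hspan, ← span_gramSchmidt_Iio, ← span_gramSchmidtNormed, Submodule.span_le]
    rintro _ ⟨t, ht, rfl⟩
    by_cases h0 : gramSchmidtNormed ℂ f t = 0
    · rw [h0]
      exact Submodule.zero_mem _
    · exact Submodule.subset_span ⟨⟨t, ht, h0⟩, rfl⟩
  have hcard : hf.toFinset.card = N := by
    have h1 := finrank_span_eq_card hon.linearIndependent
    rw [hsp, finrank_top, hN] at h1
    have : Fintype (Set.ofPred P) := hf.fintype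
    rw [h1, Set.Finite.card_toFinset]
    exact Fintype.card_congr (Equiv.refl _)
  have hlt : ∀ s : Fin N, ∀ hf : (Set.ofPred P).Finite, (s : ℕ) < hf.toFinset.card :=
    fun s _ => s.isLt.trans_eq hcard.symm
  have hmem : ∀ s : Fin N, P (Nat.nth P s) := fun s => Nat.nth_mem _ (hlt s)
  have hmono : StrictMono fun s : Fin N => Nat.nth P s := fun a b hab =>
    Nat.nth_lt_nth_of_lt_card hf hab (hlt b hf)
  have hon' : Orthonormal ℂ fun s : Fin N => gramSchmidtNormed ℂ f (Nat.nth P s) :=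
    hon.comp (fun s : Fin N => ⟨Nat.nth P s, hmem s⟩) fun a b h =>
      hmono.injective (Subtype.ext_iff.1 h)
  have hsp' := hon'.linearIndependent.span_eq_top_of_card_eq_finrank' (by
    rw [Fintype.card_fin, hN])
  refine ⟨OrthonormalBasis.mk hon' hsp'.ge, fun s => Nat.nth P s, hmono,
    fun s => Nat.le_nth (hlt s), fun s => (hmem s).1, fun s => by simp, fun s => (hmem s).2, ?_⟩
  intro s hs
  have hsL : (s : ℕ) < L := by
    by_contra hLs
    -- The first `L` vectors already span, so the Gram–Schmidt vector at `L` is zero.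
    refine hs L (by omega) ?_
    rw [← inner_self_eq_zero (𝕜 := ℂ)]
    exact inner_gramSchmidtNormed_eq_zero_of_mem_span f le_rfl (hspan ▸ Submodule.mem_top)
  have hPt : ∀ t ≤ (s : ℕ), P t := fun t ht => ⟨by omega, hs t ht⟩
  -- With no index dropped up to `s`, the enumeration by `Nat.nth` fixes `s`.
  have hcount : Nat.count P s = s := Nat.count_iff_forall.2 fun t ht => hPt t ht.le
  have h := Nat.nth_count (hPt s le_rfl)
  rwa [hcount] at h

end GramSchmidt

/-! ### Gram–Schmidt on a sequence that an operator shifts by `k`: zero entries and positive pivots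
-/

section Shift

open InnerProductSpace

variable {E : Type*} [NormedAddCommGroup E] [InnerProductSpace ℂ E] {f : ℕ → E} {k : ℕ}
  {T : E →ₗ[ℂ] E}

theorem map_mem_span_add (hT : ∀ t, f (t + k) = T (f t)) {t : ℕ} {v : E}
    (hv : v ∈ Submodule.span ℂ (f '' Set.Iio t)) :
    T v ∈ Submodule.span ℂ (f '' Set.Iio (t + k)) := by
  have h : Submodule.span ℂ (f '' Set.Iio t) ≤
      (Submodule.span ℂ (f '' Set.Iio (t + k))).comap T := by
    rw [Submodule.span_le]
    rintro _ ⟨i, hi, rfl⟩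
    rw [Set.mem_Iio] at hi
    exact Submodule.subset_span ⟨i + k, by simpa using hi, hT i⟩
  exact h hv

/-- `T` sends the `b`-th vector into the span of the terms of index at most `b + k`, to which every
later Gram–Schmidt vector is orthogonal. -/
theorem inner_gramSchmidtNormed_map_eq_zero (hT : ∀ t, f (t + k) = T (f t)) {a b : ℕ}
    (hab : b + k < a) :
    inner ℂ (gramSchmidtNormed ℂ f a) (T (gramSchmidtNormed ℂ f b)) = 0 :=
  inner_gramSchmidtNormed_eq_zero_of_mem_span f (t := b + 1 + k) (by omega)
    (map_mem_span_add hT (gramSchmidtNormed_mem_span_succ f b))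

/-- Up to a positive scalar, the image under `T` of the `b`-th vector is `f (b + k)` minus a
combination of earlier terms, so only the positive component of `f (b + k)` survives. -/
theorem inner_gramSchmidtNormed_map_pos (hT : ∀ t, f (t + k) = T (f t)) {b : ℕ}
    (hb : gramSchmidtNormed ℂ f b ≠ 0) (hbk : gramSchmidtNormed ℂ f (b + k) ≠ 0) :
    0 < inner ℂ (gramSchmidtNormed ℂ f (b + k)) (T (gramSchmidtNormed ℂ f b)) := by
  rw [gramSchmidtNormed_ne_zero_iff, ← norm_pos_iff] at hb hbk
  have h : T (gramSchmidt ℂ f b) = f (b + k) - T (f b - gramSchmidt ℂ f b) := by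
    rw [map_sub, hT]
    abel
  have hval : inner ℂ (gramSchmidtNormed ℂ f (b + k)) (T (gramSchmidtNormed ℂ f b)) =
      ((‖gramSchmidt ℂ f b‖⁻¹ * ‖gramSchmidt ℂ f (b + k)‖ : ℝ) : ℂ) := by
    rw [gramSchmidtNormed.eq_def ℂ f b, map_smul, inner_smul_right, h, inner_sub_right,
      inner_gramSchmidtNormed_self, inner_gramSchmidtNormed_eq_zero_of_mem_span f le_rfl
        (map_mem_span_add hT (sub_gramSchmidt_mem_span f b)), sub_zero]
    simp
  rw [hval]
  exact_mod_cast mul_pos (inv_pos.2 hb) hbk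

end Shift

/-! ### The sequence of columns of the block Krylov matrices -/

section KrylovSequence

variable {ι : Type*} [Fintype ι] [DecidableEq ι] {k : ℕ}

/-- The columns of `[B, A B, A² B, …]`, as vectors of the Euclidean space. -/
def krylovSequence (hk : 0 < k) (A : Matrix ι ι ℂ) (B : Matrix ι (Fin k) ℂ) (t : ℕ) :
    EuclideanSpace ℂ ι :=
  WithLp.toLp 2 ((A ^ (t / k) * B).col ⟨t % k, Nat.mod_lt t hk⟩)

variable (hk : 0 < k) (A : Matrix ι ι ℂ) (B : Matrix ι (Fin k) ℂ)

theorem krylovSequence_add (t : ℕ) :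
    krylovSequence hk A B (t + k) = Matrix.toEuclideanLin A (krylovSequence hk A B t) := by
  simp only [krylovSequence, Nat.add_div_right t hk, Nat.add_mod_right, Matrix.toLpLin_toLp]
  rw [pow_succ', Matrix.mul_assoc]
  rfl

theorem krylovSequence_of_lt {t : ℕ} (ht : t < k) :
    krylovSequence hk A B t = WithLp.toLp 2 (B.col ⟨t, ht⟩) := by
  simp only [krylovSequence, Nat.div_eq_of_lt ht, Nat.mod_eq_of_lt ht, pow_zero, Matrix.one_mul]

theorem krylovSequence_eq_col {t d : ℕ} (ht : t < (d + 1) * k) :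
    krylovSequence hk A B t = (WithLp.linearEquiv 2 ℂ (ι → ℂ)).symm ((blockKrylov A B d).col
      (⟨t / k, (Nat.div_lt_iff_lt_mul hk).2 ht⟩, ⟨t % k, Nat.mod_lt t hk⟩)) := rfl

theorem span_krylovSequence_eq_top {d : ℕ}
    (h : (blockKrylov A B d).rank = Fintype.card ι) :
    Submodule.span ℂ (krylovSequence hk A B '' Set.Iio ((d + 1) * k)) = ⊤ := by
  rw [Matrix.rank_eq_finrank_span_cols, ← Module.finrank_fintype_fun_eq_card ℂ] at h
  have htop := Submodule.eq_top_of_finrank_eq h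
  have hmap := congrArg (Submodule.map (WithLp.linearEquiv 2 ℂ (ι → ℂ)).symm.toLinearMap) htop
  rw [Submodule.map_span, Submodule.map_top, LinearEquiv.range] at hmap
  rw [eq_top_iff, ← hmap]
  refine Submodule.span_mono ?_
  rintro _ ⟨_, ⟨⟨a, c⟩, rfl⟩, rfl⟩
  have h1 : ((a : ℕ) * k + c) / k = a := by
    rw [mul_comm, Nat.mul_add_div hk, Nat.div_eq_of_lt c.isLt, add_zero]
  have h2 : ((a : ℕ) * k + c) % k = c := by
    rw [mul_comm, Nat.mul_add_mod, Nat.mod_eq_of_lt c.isLt]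
  have hlt : (a : ℕ) * k + c < (d + 1) * k := by
    rw [← Nat.div_lt_iff_lt_mul hk, h1]
    exact a.isLt
  refine ⟨(a : ℕ) * k + c, hlt, ?_⟩
  rw [krylovSequence_eq_col hk A B hlt]
  simp only [h1, h2]
  rfl

/-- Full column rank makes the first `(d + 1) * k` terms independent, so Gram–Schmidt drops none of
them. -/
theorem gramSchmidtNormed_krylovSequence_ne_zero {d : ℕ}
    (h : (blockKrylov A B d).rank = (d + 1) * k) {t : ℕ} (ht : t < (d + 1) * k) :
    InnerProductSpace.gramSchmidtNormed ℂ (krylovSequence hk A B) t ≠ 0 := by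
  have hli : LinearIndependent ℂ (blockKrylov A B d).col := by
    rw [linearIndependent_iff_card_eq_finrank_span, Set.finrank,
      ← Matrix.rank_eq_finrank_span_cols, h]
    simp
  have hli' := hli.map' (WithLp.linearEquiv 2 ℂ (ι → ℂ)).symm.toLinearMap (LinearEquiv.ker _)
  rw [gramSchmidtNormed_ne_zero_iff]
  refine InnerProductSpace.gramSchmidt_ne_zero_coe t ?_
  have hlt : ∀ s : Set.Iic t, (s : ℕ) < (d + 1) * k := fun s => lt_of_le_of_lt s.2 ht
  refine hli'.comp (fun s : Set.Iic t => (⟨(s : ℕ) / k, (Nat.div_lt_iff_lt_mul hk).2 (hlt s)⟩,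
    ⟨(s : ℕ) % k, Nat.mod_lt _ hk⟩)) fun a b hab => ?_
  simp only [Prod.mk.injEq, Fin.mk.injEq] at hab
  ext
  rw [← Nat.div_add_mod (a : ℕ) k, ← Nat.div_add_mod (b : ℕ) k, hab.1, hab.2]

end KrylovSequence

/-- If the block Krylov matrices of `A` and `B` have full rank and `B` has orthonormal columns,
then `A` is unitarily equivalent to a banded matrix in such a way that `B` corresponds to the first
`k` columns of the identity matrix. -/
theorem exists_isBanded_of_hasFullRank {ι : Type*} [Fintype ι] [DecidableEq ι] {k N : ℕ}
    (hk : 1 ≤ k) (hkN : k ≤ N) (hι : Fintype.card ι = N) {A : Matrix ι ι ℂ} (hA : A.IsHermitian)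
    {B : Matrix ι (Fin k) ℂ} (hB : Bᴴ * B = 1) (hrank : ∀ d, HasFullRank (blockKrylov A B d)) :
    ∃ J : Matrix (Fin N) (Fin N) ℂ, IsBanded k N J ∧
      ∀ i : ℕ, (J ^ i).submatrix (Fin.castLE hkN) (Fin.castLE hkN) = Bᴴ * A ^ i * B := by
  have hrank' : ∀ d, (blockKrylov A B d).rank = min N ((d + 1) * k) := by
    intro d
    rw [hrank d, hι]
    simp
  set f := krylovSequence hk A B with hf
  set T := Matrix.toEuclideanLin A with hT_def
  have hT : ∀ t, f (t + k) = T (f t) := krylovSequence_add hk A B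
  have hsymm : T.IsSymmetric := Matrix.isSymmetric_toEuclideanLin_iff.2 hA
  have hceil_pos : 0 < N ⌈/⌉ k := (lt_ceilDiv_iff_mul_lt hk N 0).2 (by omega)
  have hceil_le : N ≤ N ⌈/⌉ k * k := by
    have h := lt_ceilDiv_iff_mul_lt hk N (N ⌈/⌉ k)
    omega
  -- With `n = ⌈N/k⌉`, the Krylov matrix of order `n - 1` has `n * k ≥ N` columns, hence rank `N`.
  have hspan : Submodule.span ℂ (f '' Set.Iio (N ⌈/⌉ k * k)) = ⊤ := by
    obtain ⟨d, hd⟩ := Nat.exists_eq_succ_of_ne_zero hceil_pos.ne'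
    rw [hd] at hceil_le ⊢
    refine span_krylovSequence_eq_top hk A B ?_
    rw [hrank' d, hι, min_eq_left hceil_le]
  obtain ⟨q, p, hp, hle, hlt, hq, hne, hinit⟩ :=
    exists_orthonormalBasis_gramSchmidtNormed f (by simpa using hι) hspan
  -- As long as `(d + 1) * k ≤ N`, full rank means independent columns, so no vector is dropped in
  -- these blocks.
  have hinit' : ∀ d, (d + 1) * k ≤ N → ∀ s : Fin N, (s : ℕ) < (d + 1) * k → p s = s := by
    intro d hd s hs
    refine hinit s fun t ht => ?_
    refine gramSchmidtNormed_krylovSequence_ne_zero hk A B (d := d) ?_ (by omega)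
    rw [hrank' d, min_eq_right hd]
  set J := LinearMap.toMatrix q.toBasis q.toBasis T with hJ_def
  have hentry : ∀ (i : ℕ) r c, (J ^ i) r c = inner ℂ (q r) ((T ^ i) (q c)) := by
    intro i r c
    rw [hJ_def, LinearMap.toMatrix_pow, LinearMap.toMatrix_apply, OrthonormalBasis.coe_toBasis,
      OrthonormalBasis.coe_toBasis_repr_apply, OrthonormalBasis.repr_apply_apply]
  have hentry1 : ∀ r c, J r c = inner ℂ (q r) (T (q c)) := fun r c => by
    simpa using hentry 1 r c
  have hJ : J.IsHermitian := by
    ext r c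
    rw [Matrix.conjTranspose_apply, hentry1, hentry1, ← hsymm]
    exact inner_conj_symm _ _
  refine ⟨J, ?_, ?_⟩
  · refine isBanded_of_profile hk hJ hp hle hlt (fun j hj => hinit' j ?_) ?_ ?_
    · exact ((lt_ceilDiv_iff_mul_lt hk N (j + 1)).1 hj).le
    · intro r c hrc
      rw [hentry1, hq, hq]
      exact inner_gramSchmidtNormed_map_eq_zero hT hrc
    · intro r c hrc
      have hr := hne r
      rw [hentry1, hq, hq]
      rw [hrc] at hr ⊢
      exact inner_gramSchmidtNormed_map_pos hT (hne c) hr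
  · have hinner : ∀ (M : Matrix ι ι ℂ) (a b : Fin k),
        inner ℂ (WithLp.toLp 2 (B.col a)) (Matrix.toEuclideanLin M (WithLp.toLp 2 (B.col b))) =
          (Bᴴ * M * B) a b := by
      intro M a b
      rw [Matrix.toLpLin_toLp, EuclideanSpace.inner_toLp_toLp, dotProduct_comm, Matrix.mul_assoc]
      rfl
    have hone : ∀ a b : Fin k, inner ℂ (WithLp.toLp 2 (B.col a) : EuclideanSpace ℂ ι)
        (WithLp.toLp 2 (B.col b)) = (1 : Matrix (Fin k) (Fin k) ℂ) a b := by
      intro a b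
      rw [← hB, ← Matrix.mul_one Bᴴ, ← hinner 1 a b]
      simp
    -- The first `k` terms are the columns of `B`, already orthonormal by `hB`, so they are the
    -- first `k` basis vectors.
    have hfirst : ∀ a : Fin k, q (Fin.castLE hkN a) = WithLp.toLp 2 (B.col a) := by
      intro a
      rw [hq, hinit' 0 (by omega) _ (by simp), Fin.val_castLE,
        gramSchmidtNormed_eq_self_of_orthonormal f, hf, krylovSequence_of_lt hk A B a.isLt]
      · rw [hf, krylovSequence_of_lt hk A B a.isLt, ← sq_eq_sq₀ (norm_nonneg _) zero_le_one]
        rw [one_pow, ← inner_self_eq_norm_sq (𝕜 := ℂ), hone, Matrix.one_apply_eq,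
          RCLike.one_re]
      · intro i hi
        rw [hf, krylovSequence_of_lt hk A B a.isLt, krylovSequence_of_lt hk A B (hi.trans a.isLt),
          hone, Matrix.one_apply_ne]
        rw [ne_eq, Fin.ext_iff]
        exact hi.ne
    intro i
    have hpow : T ^ i = Matrix.toEuclideanLin (A ^ i) := by
      rw [hT_def]
      exact (Matrix.toLpLin_pow 2 A i).symm
    ext a b
    rw [Matrix.submatrix_apply, hentry, hfirst, hfirst, hpow, hinner]

end BandedSpectral

end

theorem mainTheorem5 {k N m : ℕ} (hk : 1 ≤ k) (hkN : k ≤ N)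
    (x : Fin m → ℝ) (hx : Function.Injective x)
    (n : Fin m → ℕ) (hn : ∀ j, n j ≤ k) (hN : ∑ j, n j = N)
    (V : ∀ j, Matrix (Fin k) (Fin (n j)) ℂ)
    (hμ : BandedSpectral.IsNormalizedMeasure
      (BandedSpectral.atomicMeasure x fun j => V j * (V j)ᴴ)) :
    (∃ (J : Matrix (Fin N) (Fin N) ℂ) (hJ : BandedSpectral.IsBanded k N J),
      BandedSpectral.spectralMeasure hkN J hJ.isHermitian =
        BandedSpectral.atomicMeasure x fun j => V j * (V j)ᴴ) ↔
    ∀ d : ℕ, BandedSpectral.HasFullRank (BandedSpectral.krylovMatrix x V d) := by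
  have hcard : Fintype.card (Σ j, Fin (n j)) = N := by simpa using hN
  have hX := BandedSpectral.isHermitian_pointMatrix n x
  constructor
  · rintro ⟨J, hJ, h⟩ d
    rw [BandedSpectral.spectralMeasure_eq_iff_moments] at h
    have hfull := hJ.hasFullRank_blockKrylov hk hkN d
    rw [BandedSpectral.HasFullRank, Fintype.card_fin] at hfull
    rw [BandedSpectral.HasFullRank, hcard, ← hfull, BandedSpectral.krylovMatrix_eq_blockKrylov]
    refine BandedSpectral.rank_blockKrylov_eq_of_moments hX _ hJ.isHermitian _ (fun i => ?_) d
    rw [BandedSpectral.conjTranspose_firstColumns_mul_mul, h i]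
  · intro h
    -- The total mass is the zeroth moment, so normalization says that the columns of the stacked
    -- matrix are orthonormal.
    have hone : (BandedSpectral.stackedMatrix V)ᴴ * BandedSpectral.stackedMatrix V = 1 := by
      have h0 := BandedSpectral.moments_eq_stackedMatrix x V 0
      have h1 := hμ.2
      rw [BandedSpectral.atomicMeasure_apply _ _ MeasurableSet.univ] at h1
      rw [pow_zero, Matrix.mul_one] at h0
      rw [← h0, ← h1]
      simp
    obtain ⟨J, hJ, hmom⟩ :=
      BandedSpectral.exists_isBanded_of_hasFullRank hk hkN hcard hX hone h
    exact ⟨J, hJ, (BandedSpectral.spectralMeasure_eq_iff_moments hkN J hJ.isHermitian x V).2 hmom⟩
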